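/- Let $n\ge 0$ and let $M$ be the set of all Lebesgue measurable functions $f:\mathbb{R}^n\to[0,1]$ (functions, not equivalence classes), with the supremum metric $d_\infty(f,g)=\sup_{x\in\mathbb{R}^n}|f(x)-g(x)|$. Let $K\in L^1(\mathbb{R}^n)$ be real-valued and let $G:\mathbb{R}\to\mathbb{R}$ be bounded and Lipschitz continuous. Write $[y]_0^1=\min\{\max\{0,y\},1\}$ and $(K*f)(x)=\int_{\mathbb{R}^n}K(y)f(x-y)\,dy$, and for $t\in[0,1]$ and $f\in M$ put $$X_t(f)(x):=\bigl[f(x)+t\,G\bigl((K*f)(x)\bigr)\bigr]_0^1 .$$ Then $(M,d_\infty)$ is a complete metric space, and $X:M\times[0,1]\to M$ is an arc field on it, that is, $X$ is well defined and jointly continuous and $X_0(f)=f$ for all $f\in M$. Moreover: 1. (Condition E1) For every $f_0\in M$ there are $r>0$, $\delta>0$ and $\Lambda\in\mathbb{R}$ such that for all $f,g$ in the ball $B(f_0,r)$ and all $t\in[0,1]$ with $t<\delta$, $$d_\infty(X_t(f),X_t(g))\le(1+t\Lambda)\,d_\infty(f,g).$$ 2. (Condition E2) For every $f_0\in M$ there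 are $r>0$, $\delta>0$ and $\Omega\in\mathbb{R}$ such that for all $f\in B(f_0,r)$ and all $0\le t\le s<\delta$ with $s+t\le 1$, $$d_\infty\bigl(X_{s+t}(f),X_t(X_s(f))\bigr)\le st\,\Omega.$$ 3. There is a unique forward flow $F$ that is forward tangent to $X$, that is, a unique continuous map $F:M\times[0,\infty)\to M$ such that $F_0(f)=f$ and $F_t(F_s(f))=F_{s+t}(f)$ for all $s,t\ge0$ and $f\in M$, and $$\lim_{h\to0^+}\frac{d_\infty\bigl(F_{t+h}(f),X_h(F_t(f))\bigr)}{h}=0\qquad\text{for all }t\ge0,\ f\in M.$$ 4. For all $t\ge0$ and $f\in M$, $$F_t(f)=\lim_{m\to\infty}X_{t/m}^{(m)}(f)\quad\text{in }(M,d_\infty),$$ where $X_\tau^{(m)}$ denotes the $m$-fold composition of $X_\tau$ with itself (defined for $m\ge\max\{t,1\}$). -/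

import Mathlib

open MeasureTheory Filter Topology
open scoped NNReal unitInterval

noncomputable section

/-! ### Arc fields and flows on a metric space -/

section ArcFields

variable {M : Type*} [MetricSpace M]

/-- `X : M × [0,1] → M`, written `X t f`, is an arc field: it is jointly continuous and
`X_0 = id`. -/
structure IsArcField (X : I → M → M) : Prop where
  continuous : Continuous fun p : M × I => X p.2 p.1
  zero : ∀ f, X 0 f = f

/-- Condition E1. -/
def CondE1 (X : I → M → M) : Prop :=
  ∀ f₀ : M, ∃ r > (0 : ℝ), ∃ δ > (0 : ℝ), ∃ Λ : ℝ,
    ∀ f ∈ Metric.ball f₀ r, ∀ g ∈ Metric.ball f₀ r, ∀ t : I, (t : ℝ) < δ →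
      dist (X t f) (X t g) ≤ (1 + t * Λ) * dist f g

/-- Condition E2. The time `u = s + t` ranges over `[0,1]`, where the arc field is defined. -/
def CondE2 (X : I → M → M) : Prop :=
  ∀ f₀ : M, ∃ r > (0 : ℝ), ∃ δ > (0 : ℝ), ∃ Ω : ℝ,
    ∀ f ∈ Metric.ball f₀ r, ∀ s t u : I, t ≤ s → (s : ℝ) < δ → (u : ℝ) = s + t →
      dist (X u f) (X t (X s f)) ≤ s * t * Ω

/-- `F : M × [0,∞) → M`, written `F t f`, is a forward flow. -/
structure IsForwardFlow (F : ℝ≥0 → M → M) : Prop where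
  continuous : Continuous fun p : M × ℝ≥0 => F p.2 p.1
  zero : ∀ f, F 0 f = f
  add : ∀ s t f, F t (F s f) = F (s + t) f

/-- `F` is forward tangent to `X`. -/
def IsForwardTangent (F : ℝ≥0 → M → M) (X : I → M → M) : Prop :=
  ∀ (t : ℝ≥0) (f : M),
    Tendsto (fun h : I => dist (F (t + unitInterval.toNNReal h) f) (X h (F t f)) / (h : ℝ))
      (𝓝[>] 0) (𝓝 0)

/-- `F` is a flow of the arc field `X`. -/
def IsFlowOf (F : ℝ≥0 → M → M) (X : I → M → M) : Prop :=
  IsForwardFlow F ∧ IsForwardTangent F X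

/-- The Euler iterate `X_{t/n}^{(n)} f`. It is meaningful for `n ≥ max t 1`, where `t / n` lies
in `[0,1]`; for the finitely many smaller `n` the step is replaced by its projection to `[0,1]`. -/
def eulerIterate (X : I → M → M) (t : ℝ≥0) (n : ℕ) (f : M) : M :=
  (X (Set.projIcc 0 1 zero_le_one ((t : ℝ) / n)))^[n] f

end ArcFields

/-! ### The Lenia space and the Lenia arc field -/

/-- The Lebesgue measurable functions `ℝⁿ → [0,1]` (functions, not classes of functions).
`NullMeasurable` is measurability for the completion of the Borel σ-algebra, that is, for the
Lebesgue σ-algebra. -/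
structure LeniaSpace (n : ℕ) where
  toFun : EuclideanSpace ℝ (Fin n) → ℝ
  measurable' : NullMeasurable toFun volume
  mem_Icc' : ∀ x, toFun x ∈ Set.Icc (0 : ℝ) 1

namespace LeniaSpace

variable {n : ℕ}

instance : CoeFun (LeniaSpace n) fun _ => EuclideanSpace ℝ (Fin n) → ℝ := ⟨toFun⟩

theorem ext' {f g : LeniaSpace n} (h : ∀ x, f x = g x) : f = g := by
  cases f; cases g
  congr
  exact funext h

/-- The supremum metric. -/
instance : Dist (LeniaSpace n) := ⟨fun f g => ⨆ x, |f x - g x|⟩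

theorem dist_def (f g : LeniaSpace n) : dist f g = ⨆ x, |f x - g x| := rfl

theorem bddAbove_abs_sub (f g : LeniaSpace n) : BddAbove (Set.range fun x => |f x - g x|) := by
  refine ⟨1, ?_⟩
  rintro _ ⟨x, rfl⟩
  have hf := f.mem_Icc' x
  have hg := g.mem_Icc' x
  exact abs_le.2 ⟨by linarith [hf.1, hg.2], by linarith [hf.2, hg.1]⟩

theorem abs_sub_le_dist (f g : LeniaSpace n) (x : EuclideanSpace ℝ (Fin n)) :
    |f x - g x| ≤ dist f g :=
  le_ciSup (bddAbove_abs_sub f g) x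

instance : MetricSpace (LeniaSpace n) where
  dist_self f := by simp [dist_def]
  dist_comm f g := by simp only [dist_def, abs_sub_comm]
  dist_triangle f g h := ciSup_le fun x =>
    (abs_sub_le _ (g x) _).trans (add_le_add (abs_sub_le_dist f g x) (abs_sub_le_dist g h x))
  eq_of_dist_eq_zero {f g} h := ext' fun x => by
    have := abs_sub_le_dist f g x
    rw [h] at this
    exact sub_eq_zero.1 (abs_nonpos_iff.1 this)

end LeniaSpace

/-- The clip function `[x]_a^b`. -/
def clip (a b x : ℝ) : ℝ := min (max a x) b

/-- The convolution `(K ∗ f)(x) = ∫ K(y) f(x - y) dy`. -/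
def convKernel {n : ℕ} (K f : EuclideanSpace ℝ (Fin n) → ℝ) : EuclideanSpace ℝ (Fin n) → ℝ :=
  convolution K f (ContinuousLinearMap.mul ℝ ℝ) volume

theorem aemeasurable_convKernel {n : ℕ} {K : EuclideanSpace ℝ (Fin n) → ℝ} (hK : Integrable K)
    (f : LeniaSpace n) : AEMeasurable (convKernel K f) :=
  (AEStronglyMeasurable.convolution_integrand (ContinuousLinearMap.mul ℝ ℝ)
    hK.aestronglyMeasurable
    f.measurable'.aemeasurable.aestronglyMeasurable).integral_prod_right'.aemeasurable

/-- The Lenia arc field `X_t(f)(x) = [f(x) + t G((K ∗ f)(x))]_0^1`. The hypotheses on `K` and `G`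
serve to show that `X_t(f)` is measurable. -/
def leniaArcField {n : ℕ} (K : EuclideanSpace ℝ (Fin n) → ℝ) (hK : Integrable K)
    (G : ℝ → ℝ) (hG : Continuous G) (t : I) (f : LeniaSpace n) : LeniaSpace n where
  toFun x := clip 0 1 (f x + t * G (convKernel K f x))
  measurable' := by
    have h1 : AEMeasurable f.toFun volume := f.measurable'.aemeasurable
    have h2 : AEMeasurable (fun x => G (convKernel K f x)) volume :=
      hG.measurable.comp_aemeasurable (aemeasurable_convKernel hK f)
    have h3 : AEMeasurable (fun x => clip 0 1 (f x + t * G (convKernel K f x))) volume :=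
      (aemeasurable_const.max (h1.add (h2.const_mul _))).min aemeasurable_const
    exact h3.nullMeasurable
  mem_Icc' x := ⟨le_min (le_max_left _ _) zero_le_one, min_le_right _ _⟩

end

open MeasureTheory Filter Topology
open scoped NNReal unitInterval

/-! ### Uniform arc fields and the convergence of their Euler iterates -/

section UniformArcField

variable {M : Type*} [MetricSpace M]

/-! The argument is Euler's method in a complete metric space. The Lenia step makes sense for every
`t ≥ 0` and satisfies E1 and E2 with constants that do not depend on the base point. E2 makes the
error of refining one step quadratic in its length, and E1 lets the `n` errors of size `O(1/n²)`
accumulate with only an exponential factor. Hence the Euler iterates are Cauchy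
(`dist_eulerApprox_le`). Their limit inherits continuity, the semigroup law (`limit_add`) and
tangency from these estimates. Uniqueness is a Gronwall argument for the distance between two flows
(`IsFlowOf.unique`).

For the Lenia field (`isUniformArcField_step`), E1 holds because `f ↦ G(K ∗ f)` is Lipschitz in the
supremum metric. E2 holds because clipped moves with a frozen velocity compose exactly
(`clip_clip_add`), so that only the change of velocity during the first move contributes. -/

/-- A family of maps `X t`, `t ≥ 0`, satisfying the Lipschitz and composition estimates of an
arc field globally, with constants independent of the base point. -/
structure IsUniformArcField (X : ℝ≥0 → M → M) (C B Ω : ℝ≥0) : Prop where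
  zero : ∀ f, X 0 f = f
  lipschitz : ∀ t, LipschitzWith (1 + t * C) (X t)
  lipschitz_time : ∀ f, LipschitzWith B fun t => X t f
  dist_comp_le : ∀ s t f, dist (X (s + t) f) (X t (X s f)) ≤ s * t * Ω

/-- The Euler approximation with `n` steps of length `t / n`. -/
noncomputable def eulerApprox (X : ℝ≥0 → M → M) (t : ℝ≥0) (n : ℕ) (f : M) : M :=
  (X (t / n))^[n] f

theorem eulerApprox_nat_mul {E : Type*} (X : ℝ≥0 → E → E) (h : ℝ≥0) (p n : ℕ) (f : E) :
    eulerApprox X (p * h) (p * n) f = (X (h / n))^[p * n] f := by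
  rcases eq_or_ne p 0 with rfl | hp
  · simp [eulerApprox]
  · have hp0 : (p : ℝ≥0) ≠ 0 := by exact_mod_cast hp
    rw [eulerApprox, Nat.cast_mul, mul_div_mul_left _ _ hp0]

theorem one_add_pow_le_exp (h C : ℝ≥0) (k : ℕ) :
    (1 + (h : ℝ) * C) ^ k ≤ Real.exp (C * (k * h)) := by
  have h1 : 1 + (h : ℝ) * C ≤ Real.exp (h * C) := by
    linarith [Real.add_one_le_exp ((h : ℝ) * C)]
  calc (1 + (h : ℝ) * C) ^ k ≤ Real.exp (h * C) ^ k := by gcongr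
    _ = Real.exp (C * (k * h)) := by rw [← Real.exp_nat_mul]; congr 1; ring

/-- Iterates of two uniformly close maps, one of which is Lipschitz, stay close. -/
theorem dist_iterate_iterate_le {S T : M → M} {c : ℝ≥0} (hc : 1 ≤ c) (hS : LipschitzWith c S)
    {ε : ℝ} (hε : 0 ≤ ε) (h : ∀ f, dist (S f) (T f) ≤ ε) (n : ℕ) (f : M) :
    dist (S^[n] f) (T^[n] f) ≤ n * ε * (c : ℝ) ^ n := by
  have hc' : (1 : ℝ) ≤ c := by exact_mod_cast hc
  induction n with
  | zero => simp
  | succ n ih =>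
    rw [Function.iterate_succ_apply', Function.iterate_succ_apply']
    have h1 : (1 : ℝ) ≤ (c : ℝ) ^ (n + 1) := one_le_pow₀ hc'
    calc dist (S (S^[n] f)) (T (T^[n] f))
        ≤ dist (S (S^[n] f)) (S (T^[n] f)) + dist (S (T^[n] f)) (T (T^[n] f)) :=
          dist_triangle _ _ _
      _ ≤ c * (n * ε * (c : ℝ) ^ n) + ε * (c : ℝ) ^ (n + 1) := by
          refine add_le_add ((hS.dist_le_mul _ _).trans ?_) ((h _).trans ?_)
          · gcongr
          · exact le_mul_of_one_le_right hε h1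
      _ = ((n + 1 : ℕ) : ℝ) * ε * (c : ℝ) ^ (n + 1) := by push_cast; ring

/-! ### Error estimates and convergence of Euler iterates. -/

namespace IsUniformArcField

variable {X : ℝ≥0 → M → M} {C B Ω : ℝ≥0}

theorem dist_iterate_le (hX : IsUniformArcField X C B Ω) (h : ℝ≥0) (k : ℕ) (f : M) :
    dist (X (k * h) f) ((X h)^[k] f) ≤ Ω * (k * h) ^ 2 * Real.exp (C * (k * h)) := by
  -- With the factor `(1 + h C)^k` in place of the exponential the induction closes: the new defect
  -- `k h² Ω` adds to `Ω (k h)²`, and `k + k² ≤ (k + 1)²`.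
  suffices H : dist (X (k * h) f) ((X h)^[k] f) ≤ Ω * (k * h) ^ 2 * (1 + (h : ℝ) * C) ^ k from
    H.trans (by gcongr; exact one_add_pow_le_exp h C k)
  induction k with
  | zero => simp [hX.zero]
  | succ k ih =>
    rw [Function.iterate_succ_apply']
    have e : ((k + 1 : ℕ) : ℝ≥0) * h = k * h + h := by push_cast; ring
    have h0 : (1 : ℝ) ≤ 1 + (h : ℝ) * C := le_add_of_nonneg_right (by positivity)
    have h1 : (1 : ℝ) ≤ (1 + (h : ℝ) * C) ^ (k + 1) := one_le_pow₀ h0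
    have h2 := hX.dist_comp_le (k * h) h f
    have h3 := (hX.lipschitz h).dist_le_mul (X (k * h) f) ((X h)^[k] f)
    push_cast at h2 h3
    rw [e]
    calc dist (X (k * h + h) f) (X h ((X h)^[k] f))
        ≤ dist (X (k * h + h) f) (X h (X (k * h) f))
          + dist (X h (X (k * h) f)) (X h ((X h)^[k] f)) := dist_triangle _ _ _
      _ ≤ k * h * h * Ω * (1 + (h : ℝ) * C) ^ (k + 1)
          + (1 + h * C) * (Ω * (k * h) ^ 2 * (1 + (h : ℝ) * C) ^ k) := by
          refine add_le_add (h2.trans (le_mul_of_one_le_right (by positivity) h1)) (h3.trans ?_)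
          gcongr
      _ = Ω * (h : ℝ) ^ 2 * (k + k ^ 2) * (1 + (h : ℝ) * C) ^ (k + 1) := by ring
      _ ≤ Ω * (h : ℝ) ^ 2 * (k + 1) ^ 2 * (1 + (h : ℝ) * C) ^ (k + 1) := by
          gcongr
          nlinarith [(k.cast_nonneg : (0 : ℝ) ≤ k)]
      _ = Ω * (((k + 1 : ℕ) : ℝ) * h) ^ 2 * (1 + (h : ℝ) * C) ^ (k + 1) := by push_cast; ring

/-- Each step of length `t / n` is replaced by `k` equal substeps, at a cost of order `(t / n)²`.
Over `n` steps these costs add up to order `1 / n`, uniformly in `k`. -/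
theorem dist_eulerApprox_mul_le (hX : IsUniformArcField X C B Ω) (t : ℝ≥0) {n k : ℕ}
    (hn : n ≠ 0) (hk : k ≠ 0) (f : M) :
    dist (eulerApprox X t n f) (eulerApprox X t (n * k) f)
      ≤ Ω * t ^ 2 * Real.exp (2 * C * t) / n := by
  have hn0 : (n : ℝ) ≠ 0 := by exact_mod_cast hn
  have hk0 : (k : ℝ≥0) ≠ 0 := by exact_mod_cast hk
  have hn1 : (1 : ℝ) ≤ n := by exact_mod_cast Nat.one_le_iff_ne_zero.2 hn
  have e : (t / (n * k : ℕ) : ℝ≥0) = t / n / k := by push_cast; rw [div_div]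
  have hloc : ∀ g, dist (X (t / n) g) ((X (t / n / k))^[k] g)
      ≤ Ω * (t / n) ^ 2 * Real.exp (C * t) := by
    intro g
    have h1 := hX.dist_iterate_le (t / n / k) k g
    have h2 : (k : ℝ≥0) * (t / n / k) = t / n := mul_div_cancel₀ _ hk0
    have h3 : (k : ℝ) * ((t / n / k : ℝ≥0) : ℝ) = t / n := by
      have := congrArg NNReal.toReal h2
      simpa using this
    rw [h2, h3] at h1
    refine h1.trans ?_
    gcongr
    exact div_le_self t.2 hn1
  have h4 := dist_iterate_iterate_le (c := 1 + t / n * C) le_self_add (hX.lipschitz (t / n))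
    (by positivity) hloc n f
  have h5 := one_add_pow_le_exp (t / n) C n
  push_cast at h4 h5
  rw [mul_div_cancel₀ _ hn0] at h5
  unfold eulerApprox
  rw [e, mul_comm n k, Function.iterate_mul]
  calc _ ≤ _ := h4
    _ ≤ n * (Ω * (t / n) ^ 2 * Real.exp (C * t)) * Real.exp (C * t) := by gcongr
    _ = Ω * t ^ 2 * (Real.exp (C * t) * Real.exp (C * t)) / n := by field_simp
    _ = _ := by rw [← Real.exp_add]; congr 3; ring

theorem dist_eulerApprox_le (hX : IsUniformArcField X C B Ω) (t : ℝ≥0) {n m : ℕ}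
    (hn : n ≠ 0) (hm : m ≠ 0) (f : M) :
    dist (eulerApprox X t n f) (eulerApprox X t m f)
      ≤ Ω * t ^ 2 * Real.exp (2 * C * t) / n + Ω * t ^ 2 * Real.exp (2 * C * t) / m := by
  refine (dist_triangle_right _ _ (eulerApprox X t (n * m) f)).trans (add_le_add
    (hX.dist_eulerApprox_mul_le t hn hm f) ?_)
  rw [mul_comm n m]
  exact hX.dist_eulerApprox_mul_le t hm hn f

theorem exists_tendsto_eulerApprox [CompleteSpace M] (hX : IsUniformArcField X C B Ω) (t : ℝ≥0)
    (f : M) : ∃ g, Tendsto (fun n => eulerApprox X t n f) atTop (𝓝 g) := by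
  refine cauchySeq_tendsto_of_complete (Metric.cauchySeq_iff'.2 fun ε hε => ?_)
  set A := Ω * (t : ℝ) ^ 2 * Real.exp (2 * C * t)
  have hA : Tendsto (fun n : ℕ => A / n) atTop (𝓝 0) := tendsto_const_div_atTop_nhds_zero_nat A
  obtain ⟨N, hN⟩ := eventually_atTop.1 (hA.eventually_lt_const (half_pos hε))
  refine ⟨N + 1, fun n hn => ?_⟩
  have := hX.dist_eulerApprox_le t (n := n) (m := N + 1) (by omega) (by omega) f
  linarith [hN n (by omega), hN (N + 1) (by omega)]

theorem dist_eulerApprox_eulerApprox_le (hX : IsUniformArcField X C B Ω) (t : ℝ≥0) {n : ℕ}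
    (hn : n ≠ 0) (f g : M) :
    dist (eulerApprox X t n f) (eulerApprox X t n g) ≤ Real.exp (C * t) * dist f g := by
  have h1 := ((hX.lipschitz (t / n)).iterate n).dist_le_mul f g
  have h2 := one_add_pow_le_exp (t / n) C n
  push_cast at h1 h2
  rw [mul_div_cancel₀ _ (by exact_mod_cast hn : (n : ℝ) ≠ 0)] at h2
  exact h1.trans (by gcongr)

theorem dist_eulerApprox_time_le (hX : IsUniformArcField X C B Ω) (s t : ℝ≥0) {n : ℕ}
    (hn : n ≠ 0) (f : M) :
    dist (eulerApprox X s n f) (eulerApprox X t n f) ≤ B * dist s t * Real.exp (C * s) := by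
  have hn0 : (n : ℝ) ≠ 0 := by exact_mod_cast hn
  have h1 := dist_iterate_iterate_le (c := 1 + s / n * C) le_self_add (hX.lipschitz (s / n))
    (by positivity) (fun g => (hX.lipschitz_time g).dist_le_mul (s / n) (t / n)) n f
  have h2 := one_add_pow_le_exp (s / n) C n
  have h3 : dist (s / n) (t / n) = dist s t / n := by
    rw [NNReal.dist_eq, NNReal.dist_eq]
    push_cast
    rw [← sub_div, abs_div, Nat.abs_cast]
  push_cast at h1 h2
  rw [mul_div_cancel₀ _ hn0] at h2
  rw [h3] at h1
  calc _ ≤ _ := h1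
    _ ≤ n * (B * (dist s t / n)) * Real.exp (C * s) := by gcongr
    _ = _ := by field_simp

/-! ### The Euler limit as a flow tangent to the arc field. -/

variable {F : ℝ≥0 → M → M}

theorem dist_limit_le (hX : IsUniformArcField X C B Ω)
    (hF : ∀ t f, Tendsto (fun n => eulerApprox X t n f) atTop (𝓝 (F t f))) (t : ℝ≥0) (f g : M) :
    dist (F t f) (F t g) ≤ Real.exp (C * t) * dist f g :=
  le_of_tendsto ((hF t f).dist (hF t g)) <| (eventually_ne_atTop 0).mono fun _ hn =>
    hX.dist_eulerApprox_eulerApprox_le t hn f g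

theorem dist_limit_time_le (hX : IsUniformArcField X C B Ω)
    (hF : ∀ t f, Tendsto (fun n => eulerApprox X t n f) atTop (𝓝 (F t f))) (s t : ℝ≥0) (f : M) :
    dist (F s f) (F t f) ≤ B * dist s t * Real.exp (C * s) :=
  le_of_tendsto ((hF s f).dist (hF t f)) <| (eventually_ne_atTop 0).mono fun _ hn =>
    hX.dist_eulerApprox_time_le s t hn f

/-- This is the refinement estimate started from a single step. The bound is quadratic in `t`, which
gives tangency after division by `t`. -/
theorem dist_limit_arc_le (hX : IsUniformArcField X C B Ω)
    (hF : ∀ t f, Tendsto (fun n => eulerApprox X t n f) atTop (𝓝 (F t f))) (t : ℝ≥0) (f : M) :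
    dist (F t f) (X t f) ≤ Ω * t ^ 2 * Real.exp (2 * C * t) := by
  refine le_of_tendsto ((hF t f).dist tendsto_const_nhds) <|
    (eventually_ne_atTop 0).mono fun n hn => ?_
  have := hX.dist_eulerApprox_mul_le t one_ne_zero hn f
  rw [dist_comm]
  simpa [eulerApprox] using this

theorem continuous_limit (hX : IsUniformArcField X C B Ω)
    (hF : ∀ t f, Tendsto (fun n => eulerApprox X t n f) atTop (𝓝 (F t f))) :
    Continuous fun p : M × ℝ≥0 => F p.2 p.1 := by
  refine continuous_iff_continuousAt.2 fun ⟨f₀, t₀⟩ => ?_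
  refine tendsto_iff_dist_tendsto_zero.2 ?_
  have hlim : Tendsto (fun p : M × ℝ≥0 => Real.exp (C * p.2) * dist p.1 f₀
      + B * dist p.2 t₀ * Real.exp (C * p.2)) (𝓝 (f₀, t₀)) (𝓝 0) := by
    have : Continuous fun p : M × ℝ≥0 => Real.exp (C * p.2) * dist p.1 f₀
      + B * dist p.2 t₀ * Real.exp (C * p.2) := by fun_prop
    simpa using this.tendsto (f₀, t₀)
  refine squeeze_zero (fun _ => dist_nonneg) (fun p => ?_) hlim
  exact (dist_triangle _ (F p.2 f₀) _).trans
    (add_le_add (hX.dist_limit_le hF _ _ _) (hX.dist_limit_time_le hF _ _ _))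

theorem tendsto_iterate_nat_mul (hX : IsUniformArcField X C B Ω)
    (hF : ∀ t f, Tendsto (fun n => eulerApprox X t n f) atTop (𝓝 (F t f)))
    (h : ℝ≥0) (p : ℕ) (f : M) :
    Tendsto (fun n : ℕ => (X (h / n))^[p * n] f) atTop (𝓝 (F (p * h) f)) := by
  -- For `p = 0` the indices `p * n` do not tend to infinity, so the subsequence argument needs `p ≠
  -- 0`.
  rcases eq_or_ne p 0 with rfl | hp
  · have : F 0 f = f := tendsto_nhds_unique (hF 0 f) <| by
      have : ∀ n : ℕ, eulerApprox X 0 n f = f := fun n => by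
        rw [eulerApprox, zero_div]
        exact Function.iterate_fixed (hX.zero f) n
      simp [this]
    simp [this]
  · simp_rw [← eulerApprox_nat_mul]
    exact (hF _ f).comp (tendsto_id.const_mul_atTop' (Nat.pos_of_ne_zero hp))

/-- Commensurable times share the step `h / n`, so the iterates compose exactly before the limit;
the Lipschitz bound, uniform in `n`, allows the inner iterate to be replaced by its limit. -/
theorem limit_nat_mul_add (hX : IsUniformArcField X C B Ω)
    (hF : ∀ t f, Tendsto (fun n => eulerApprox X t n f) atTop (𝓝 (F t f)))
    (h : ℝ≥0) (p q : ℕ) (f : M) : F (q * h) (F (p * h) f) = F (p * h + q * h) f := by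
  have h1 := hX.tendsto_iterate_nat_mul hF h (p + q) f
  rw [Nat.cast_add, add_mul] at h1
  refine tendsto_nhds_unique ?_ h1
  refine tendsto_iff_dist_tendsto_zero.2 ?_
  have h2 := tendsto_iff_dist_tendsto_zero.1 (hX.tendsto_iterate_nat_mul hF h p f)
  have h3 := tendsto_iff_dist_tendsto_zero.1 (hX.tendsto_iterate_nat_mul hF h q (F (p * h) f))
  have hlim := (h2.const_mul (Real.exp (C * (q * h)))).add h3
  simp only [mul_zero, add_zero] at hlim
  refine squeeze_zero' (Eventually.of_forall fun _ => dist_nonneg) ?_ hlim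
  filter_upwards [eventually_ne_atTop 0] with n hn
  rw [add_mul, add_comm, Function.iterate_add_apply]
  refine (dist_triangle _ ((X (h / n))^[q * n] (F (p * h) f)) _).trans (add_le_add ?_ le_rfl)
  rcases eq_or_ne q 0 with rfl | hq
  · simp
  · have := hX.dist_eulerApprox_eulerApprox_le (q * h) (mul_ne_zero hq hn)
      ((X (h / n))^[p * n] f) (F (p * h) f)
    rw [eulerApprox_nat_mul, eulerApprox_nat_mul] at this
    simpa using this

theorem limit_add (hX : IsUniformArcField X C B Ω)
    (hF : ∀ t f, Tendsto (fun n => eulerApprox X t n f) atTop (𝓝 (F t f)))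
    (s t : ℝ≥0) (f : M) : F t (F s f) = F (s + t) f := by
  have hc := hX.continuous_limit hF
  -- Approximating `s` and `t` by multiples of the same `1 / N` reduces the law to commensurable
  -- times; joint continuity does the rest.
  have hfl : ∀ a : ℝ≥0, Tendsto (fun N : ℕ => (⌊a * N⌋₊ : ℝ≥0) * (1 / N)) atTop (𝓝 a) := by
    intro a
    have := (tendsto_nat_floor_mul_div_atTop a.2).comp tendsto_natCast_atTop_atTop
    rw [← NNReal.tendsto_coe]
    refine this.congr fun N => ?_
    have e : ⌊(a : ℝ) * N⌋₊ = ⌊a * N⌋₊ := by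
      rfl
    simp only [Function.comp_apply]
    push_cast
    rw [← e, mul_one_div]
    rfl
  have hs := hfl s
  have ht := hfl t
  have h1 : Tendsto (fun N : ℕ => F ((⌊s * N⌋₊ : ℝ≥0) * (1 / N)) f) atTop (𝓝 (F s f)) :=
    (hc.tendsto (f, s)).comp (tendsto_const_nhds.prodMk_nhds hs)
  have h2 := (hc.tendsto (F s f, t)).comp (h1.prodMk_nhds ht)
  have h3 := (hc.tendsto (f, s + t)).comp (tendsto_const_nhds.prodMk_nhds (hs.add ht))
  refine tendsto_nhds_unique h2 (h3.congr fun N => ?_)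
  exact (hX.limit_nat_mul_add hF (1 / N) _ _ f).symm

theorem isForwardFlow_limit (hX : IsUniformArcField X C B Ω)
    (hF : ∀ t f, Tendsto (fun n => eulerApprox X t n f) atTop (𝓝 (F t f))) :
    IsForwardFlow F where
  continuous := hX.continuous_limit hF
  zero f := by
    have := hX.dist_limit_arc_le hF 0 f
    rw [hX.zero] at this
    exact dist_le_zero.1 (by simpa using this)
  add := hX.limit_add hF

theorem isForwardTangent_limit (hX : IsUniformArcField X C B Ω)
    (hF : ∀ t f, Tendsto (fun n => eulerApprox X t n f) atTop (𝓝 (F t f))) :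
    IsForwardTangent F fun t : I => X (unitInterval.toNNReal t) := by
  intro t f
  have hlim : Tendsto (fun h : I => Ω * (h : ℝ) * Real.exp (2 * C * h)) (𝓝[>] 0) (𝓝 0) := by
    have : Continuous fun h : I => Ω * (h : ℝ) * Real.exp (2 * C * h) := by fun_prop
    simpa using (this.tendsto 0).mono_left nhdsWithin_le_nhds
  refine squeeze_zero' (Eventually.of_forall fun h => div_nonneg dist_nonneg h.2.1) ?_ hlim
  filter_upwards [self_mem_nhdsWithin] with h hh
  have hpos : (0 : ℝ) < h := hh
  have := hX.dist_limit_arc_le hF (unitInterval.toNNReal h) (F t f)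
  rw [hX.limit_add hF] at this
  rw [div_le_iff₀ hpos]
  refine this.trans_eq ?_
  rw [unitInterval.coe_toNNReal]
  ring

end IsUniformArcField

/-! ### Uniqueness of the flow. -/

theorem IsForwardFlow.continuous_time {F : ℝ≥0 → M → M} (hF : IsForwardFlow F) (f : M) :
    Continuous fun t => F t f :=
  hF.continuous.comp (Continuous.prodMk_right f)

/-- Two flows of an arc field with globally Lipschitz time steps coincide. -/
theorem IsFlowOf.unique {X : I → M → M} {C : ℝ≥0}
    (hX : ∀ (t : I) f g, dist (X t f) (X t g) ≤ (1 + t * C) * dist f g)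
    {F F' : ℝ≥0 → M → M} (hF : IsFlowOf F X) (hF' : IsFlowOf F' X) : F' = F := by
  funext T f
  let φ : ℝ → ℝ := fun t => dist (F' t.toNNReal f) (F t.toNNReal f)
  have hφ : Continuous φ :=
    ((hF'.1.continuous_time f).comp continuous_real_toNNReal).dist
      ((hF.1.continuous_time f).comp continuous_real_toNNReal)
  have hbound := le_gronwallBound_of_liminf_deriv_right_le (f := φ) (f' := fun t => C * φ t)
    (δ := 0) (K := C) (ε := 0) (a := 0) (b := T) hφ.continuousOn ?_ ?_ (by simp) T
    (Set.right_mem_Icc.2 T.2)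
  · have : φ T ≤ 0 := by simpa [gronwallBound_ε0_δ0] using hbound
    exact dist_le_zero.1 (by simpa [φ] using this)
  · intro x hx r hr
    have hx0 : 0 ≤ x := hx.1
    set t := x.toNNReal
    have h1 := hF.2 t f
    have h2 := hF'.2 t f
    have h12 := h2.add h1
    rw [add_zero] at h12
    have hev := h12.eventually_lt_const (sub_pos.2 hr)
    -- Tangency is a limit over `h` in `[0,1]`, Gronwall's inequality one over `z` to the right of
    -- `x`; `h = z - x`, projected to `[0,1]`, links the two.
    have hmap : Tendsto (fun z : ℝ => Set.projIcc (0 : ℝ) 1 zero_le_one (z - x))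
        (𝓝[>] x) (𝓝[>] (0 : I)) := by
      refine tendsto_nhdsWithin_iff.2 ⟨?_, ?_⟩
      · have : Continuous fun z : ℝ => Set.projIcc (0 : ℝ) 1 zero_le_one (z - x) :=
          continuous_projIcc.comp (by fun_prop)
        have h0 := (this.tendsto x).mono_left (nhdsWithin_le_nhds (s := Set.Ioi x))
        simpa [Set.projIcc_left] using h0
      · filter_upwards [self_mem_nhdsWithin] with z hz
        change (0 : ℝ) < _
        simpa [Set.coe_projIcc] using hz
    refine Eventually.frequently ?_
    filter_upwards [hmap.eventually hev, self_mem_nhdsWithin,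
      Ioo_mem_nhdsGT (lt_add_one x)] with z hz hzx hz1
    have hpos : 0 < z - x := sub_pos.2 hzx
    set h : I := Set.projIcc (0 : ℝ) 1 zero_le_one (z - x)
    have hh : (h : ℝ) = z - x := by
      have : z - x ∈ Set.Icc (0 : ℝ) 1 := ⟨hpos.le, by linarith [hz1.2]⟩
      exact congrArg Subtype.val (Set.projIcc_of_mem zero_le_one this)
    have ht : t + unitInterval.toNNReal h = z.toNNReal := by
      apply NNReal.coe_injective
      rw [NNReal.coe_add, unitInterval.coe_toNNReal, hh, Real.coe_toNNReal _ hx0,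
        Real.coe_toNNReal _ (by linarith)]
      ring
    rw [ht, hh, ← add_div, div_lt_iff₀ hpos] at hz
    rw [inv_mul_lt_iff₀ hpos]
    have h3 := hX h (F' t f) (F t f)
    rw [hh] at h3
    -- Both tangency errors together are below `h (r - C φ x)` and the middle distance is at most
    -- `(1 + h C) φ x`, so `φ` grows by less than `h r`.
    have h4 := dist_triangle4 (F' z.toNNReal f) (X h (F' t f)) (X h (F t f)) (F z.toNNReal f)
    rw [dist_comm (X h (F t f))] at h4
    change dist (F' z.toNNReal f) (F z.toNNReal f) - dist (F' t f) (F t f) < _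
    have h5 : φ x = dist (F' t f) (F t f) := rfl
    rw [h5] at hz
    nlinarith
  · simp [φ, hF.1.zero, hF'.1.zero]

theorem eulerIterate_eventuallyEq {E : Type*} (X : ℝ≥0 → E → E) (t : ℝ≥0) (f : E) :
    (fun n => eulerIterate (fun t : I => X (unitInterval.toNNReal t)) t n f)
      =ᶠ[atTop] fun n => eulerApprox X t n f := by
  filter_upwards [eventually_ge_atTop (max 1 ⌈(t : ℝ)⌉₊)] with n hn
  have hn1 : (1 : ℝ) ≤ n := by exact_mod_cast (le_max_left _ _).trans hn
  have ht : (t : ℝ) ≤ n := Nat.ceil_le.1 ((le_max_right _ _).trans hn)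
  have hmem : (t : ℝ) / n ∈ Set.Icc (0 : ℝ) 1 :=
    ⟨by positivity, div_le_one_of_le₀ ht (by positivity)⟩
  have : unitInterval.toNNReal (Set.projIcc 0 1 zero_le_one ((t : ℝ) / n)) = t / n := by
    apply NNReal.coe_injective
    rw [unitInterval.coe_toNNReal, Set.projIcc_of_mem zero_le_one hmem]
    push_cast
    rfl
  simp only [eulerIterate, eulerApprox, this]

end UniformArcField

/-! ### The Lenia space and the Lenia arc field -/

theorem abs_clip_sub_clip_le (a b x y : ℝ) : |clip a b x - clip a b y| ≤ |x - y| := by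
  unfold clip
  refine (abs_min_sub_min_le_max _ _ _ _).trans (max_le ?_ (by simp))
  refine (abs_max_sub_max_le_max _ _ _ _).trans (max_le (by simp) le_rfl)

/-- Moving a point of `[a, b]` by `s * v` and then by `t * v`, clipping after each move, amounts to
one clipped move. -/
theorem clip_clip_add {a b x s t : ℝ} (hx : x ∈ Set.Icc a b) (hs : 0 ≤ s) (ht : 0 ≤ t) (v : ℝ) :
    clip a b (clip a b (x + s * v) + t * v) = clip a b (x + (s + t) * v) := by
  obtain ⟨h1, h2⟩ := hx
  have e : x + (s + t) * v = x + s * v + t * v := by ring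
  rw [e]
  unfold clip
  -- Both moves go in the same direction, so only one endpoint can be hit, and a point that has hit
  -- it stays there.
  rcases le_total 0 v with hv | hv
  · have := mul_nonneg hs hv
    have := mul_nonneg ht hv
    grind
  · have := mul_nonpos_of_nonneg_of_nonpos hs hv
    have := mul_nonpos_of_nonneg_of_nonpos ht hv
    grind

namespace LeniaSpace

variable {n : ℕ}

theorem dist_le_of_forall {f g : LeniaSpace n} {c : ℝ} (h : ∀ x, |f x - g x| ≤ c) :
    dist f g ≤ c :=
  ciSup_le h

/-- A Cauchy sequence converges pointwise, and Lebesgue measurability and the bounds `[0,1]` survive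
pointwise limits. -/
instance : CompleteSpace (LeniaSpace n) := by
  refine Metric.complete_of_cauchySeq_tendsto fun u hu => ?_
  have hpt : ∀ x, CauchySeq fun k => u k x := fun x =>
    (LipschitzWith.of_dist_le_mul (K := 1) (f := fun f : LeniaSpace n => f x) fun f g => by
      simpa [Real.dist_eq] using abs_sub_le_dist f g x).uniformContinuous.comp_cauchySeq hu
  choose g hg using fun x => cauchySeq_tendsto_of_complete (hpt x)
  let g' : LeniaSpace n :=
    { toFun := g
      measurable' := (aemeasurable_of_tendsto_metrizable_ae atTop
        (fun k => (u k).measurable'.aemeasurable) (ae_of_all _ hg)).nullMeasurable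
      mem_Icc' := fun x => isClosed_Icc.mem_of_tendsto (hg x)
        (Eventually.of_forall fun k => (u k).mem_Icc' x) }
  refine ⟨g', Metric.tendsto_atTop.2 fun ε hε => ?_⟩
  obtain ⟨N, hN⟩ := Metric.cauchySeq_iff.1 hu (ε / 2) (half_pos hε)
  refine ⟨N, fun k hk => (dist_le_of_forall fun x => ?_).trans_lt (half_lt_self hε)⟩
  refine le_of_tendsto ((tendsto_const_nhds.sub (hg x)).abs) ?_
  filter_upwards [eventually_ge_atTop N] with m hm
  exact (abs_sub_le_dist (u k) (u m) x).trans (hN k hk m hm).le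

theorem integrable_kernel_mul {K : EuclideanSpace ℝ (Fin n) → ℝ} (hK : Integrable K)
    (f : LeniaSpace n) (x : EuclideanSpace ℝ (Fin n)) :
    Integrable fun y => K y * f (x - y) := by
  refine hK.mul_bdd (c := 1) ?_ (ae_of_all _ fun y => ?_)
  · exact f.measurable'.aemeasurable.aestronglyMeasurable.comp_quasiMeasurePreserving
      (quasiMeasurePreserving_sub_left volume x)
  · have := f.mem_Icc' (x - y)
    exact abs_le.2 ⟨by linarith [this.1], this.2⟩

theorem abs_convKernel_sub_le {K : EuclideanSpace ℝ (Fin n) → ℝ} (hK : Integrable K)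
    (f g : LeniaSpace n) (x : EuclideanSpace ℝ (Fin n)) :
    |convKernel K f x - convKernel K g x| ≤ (∫ y, ‖K y‖) * dist f g := by
  have h : convKernel K f x - convKernel K g x = ∫ y, K y * (f (x - y) - g (x - y)) := by
    simp only [convKernel, convolution, ContinuousLinearMap.mul_apply', mul_sub]
    exact (integral_sub (integrable_kernel_mul hK f x) (integrable_kernel_mul hK g x)).symm
  rw [h, ← integral_mul_const, ← Real.norm_eq_abs]
  refine norm_integral_le_of_norm_le (hK.norm.mul_const _) (ae_of_all _ fun y => ?_)
  rw [norm_mul]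
  exact mul_le_mul_of_nonneg_left (abs_sub_le_dist f g _) (norm_nonneg _)

/-- The Lenia step `[f + t G(K ∗ f)]_0^1` for an arbitrary time `t ≥ 0`. -/
noncomputable def step (K : EuclideanSpace ℝ (Fin n) → ℝ) (hK : Integrable K)
    (G : ℝ → ℝ) (hG : Continuous G) (t : ℝ≥0) (f : LeniaSpace n) : LeniaSpace n where
  toFun x := clip 0 1 (f x + t * G (convKernel K f x))
  measurable' := ((aemeasurable_const.max (f.measurable'.aemeasurable.add
    ((hG.measurable.comp_aemeasurable (aemeasurable_convKernel hK f)).const_mul _))).min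
      aemeasurable_const).nullMeasurable
  mem_Icc' _ := ⟨le_min (le_max_left _ _) zero_le_one, min_le_right _ _⟩

theorem isUniformArcField_step {K : EuclideanSpace ℝ (Fin n) → ℝ} (hK : Integrable K)
    {G : ℝ → ℝ} {L : ℝ≥0} (hG : LipschitzWith L G) {B : ℝ≥0} (hB : ∀ y, |G y| ≤ B) :
    IsUniformArcField (step K hK G hG.continuous) (L * (∫ y, ‖K y‖).toNNReal) B
      (L * (∫ y, ‖K y‖).toNNReal * B) := by
  have hK0 : 0 ≤ ∫ y, ‖K y‖ := integral_nonneg fun _ => norm_nonneg _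
  have hC : ∀ (f g : LeniaSpace n) x, |G (convKernel K f x) - G (convKernel K g x)| ≤
      (L * (∫ y, ‖K y‖).toNNReal : ℝ≥0) * dist f g := by
    intro f g x
    have h1 := hG.dist_le_mul (convKernel K f x) (convKernel K g x)
    rw [Real.dist_eq, Real.dist_eq] at h1
    rw [NNReal.coe_mul, Real.coe_toNNReal _ hK0, mul_assoc]
    exact h1.trans (mul_le_mul_of_nonneg_left (abs_convKernel_sub_le hK f g x) L.2)
  generalize L * (∫ y, ‖K y‖).toNNReal = C at hC
  have hzero : ∀ f, step K hK G hG.continuous 0 f = f := fun f => ext' fun x => by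
    have := f.mem_Icc' x
    simp [step, clip, this.1, this.2]
  have htime : ∀ f, LipschitzWith B fun t => step K hK G hG.continuous t f := fun f =>
    LipschitzWith.of_dist_le_mul fun s t => dist_le_of_forall fun x => by
      refine (abs_clip_sub_clip_le _ _ _ _).trans ?_
      rw [add_sub_add_left_eq_sub, ← sub_mul, abs_mul, mul_comm, NNReal.dist_eq]
      exact mul_le_mul_of_nonneg_right (hB _) (abs_nonneg _)
  refine ⟨hzero, fun t => ?_, htime, fun s t f => ?_⟩
  · refine LipschitzWith.of_dist_le_mul fun f g => dist_le_of_forall fun x => ?_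
    refine (abs_clip_sub_clip_le _ _ _ _).trans ?_
    rw [add_sub_add_comm, ← mul_sub]
    refine (abs_add_le _ _).trans ?_
    rw [abs_mul, NNReal.abs_eq]
    have h1 := mul_le_mul_of_nonneg_left (hC f g x) t.coe_nonneg
    have h2 := abs_sub_le_dist f g x
    push_cast
    linarith
  · refine dist_le_of_forall fun x => ?_
    set g := step K hK G hG.continuous s f
    -- The long step equals the composite with the velocity frozen at `f`. What remains is the
    -- change of velocity from `f` to `g`, at most `C B s`, acting for time `t`.
    have h1 : step K hK G hG.continuous (s + t) f x
        = clip 0 1 (g x + t * G (convKernel K f x)) := by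
      change clip 0 1 (f x + ((s + t : ℝ≥0) : ℝ) * _) = clip 0 1 (clip 0 1 _ + _)
      rw [clip_clip_add (f.mem_Icc' x) s.coe_nonneg t.coe_nonneg, NNReal.coe_add]
    rw [h1]
    refine (abs_clip_sub_clip_le _ _ _ _).trans ?_
    rw [add_sub_add_left_eq_sub, ← mul_sub, abs_mul, NNReal.abs_eq]
    have h2 : dist f g ≤ B * s := by
      have := (htime f).dist_le_mul 0 s
      simpa [hzero, NNReal.dist_eq] using this
    calc (t : ℝ) * |G (convKernel K f x) - G (convKernel K g x)|
        ≤ t * (C * (B * s)) := by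
          gcongr
          exact (hC f g x).trans (by gcongr)
      _ = s * t * (C * B : ℝ≥0) := by push_cast; ring

end LeniaSpace

theorem mainTheorem1 (n : ℕ) (K : EuclideanSpace ℝ (Fin n) → ℝ) (hK : Integrable K volume)
    (G : ℝ → ℝ) (L : ℝ≥0) (hG : LipschitzWith L G) (hGb : ∃ B : ℝ, ∀ y, |G y| ≤ B) :
    CompleteSpace (LeniaSpace n) ∧
    IsArcField (leniaArcField K hK G hG.continuous) ∧
    CondE1 (leniaArcField K hK G hG.continuous) ∧
    CondE2 (leniaArcField K hK G hG.continuous) ∧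
    ∃ F : ℝ≥0 → LeniaSpace n → LeniaSpace n,
      IsFlowOf F (leniaArcField K hK G hG.continuous) ∧
      (∀ F' : ℝ≥0 → LeniaSpace n → LeniaSpace n,
        IsFlowOf F' (leniaArcField K hK G hG.continuous) → F' = F) ∧
      ∀ (t : ℝ≥0) (f : LeniaSpace n),
        Tendsto (fun m : ℕ => eulerIterate (leniaArcField K hK G hG.continuous) t m f)
          atTop (𝓝 (F t f)) := by
  obtain ⟨B, hB⟩ := hGb
  have hX := LeniaSpace.isUniformArcField_step hK hG (B := B.toNNReal)
    fun y => (hB y).trans (Real.le_coe_toNNReal B)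
  have hstep : leniaArcField K hK G hG.continuous =
      fun t : I => LeniaSpace.step K hK G hG.continuous (unitInterval.toNNReal t) := rfl
  rw [hstep]
  generalize LeniaSpace.step K hK G hG.continuous = X at hX
  generalize L * (∫ y, ‖K y‖).toNNReal = C at hX
  have hlip : ∀ (t : I) f g, dist (X (unitInterval.toNNReal t) f) (X (unitInterval.toNNReal t) g)
      ≤ (1 + t * C) * dist f g := fun t f g => by
    simpa using (hX.lipschitz (unitInterval.toNNReal t)).dist_le_mul f g
  choose F hF using hX.exists_tendsto_eulerApprox
  have hflow : IsFlowOf F fun t : I => X (unitInterval.toNNReal t) :=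
    ⟨hX.isForwardFlow_limit hF, hX.isForwardTangent_limit hF⟩
  -- The estimates are global, so the radius and `δ` are arbitrary and set to `1`.
  refine ⟨inferInstance, ⟨?_, fun f => ?_⟩, fun _ => ⟨1, one_pos, 1, one_pos, C, ?_⟩,
    fun _ => ⟨1, one_pos, 1, one_pos, C * B.toNNReal, ?_⟩, F, hflow,
    fun F' hF' => hflow.unique hlip hF', fun t f => ?_⟩
  -- Since `t ≤ 1`, the Lipschitz constants `1 + t C` have the common bound `1 + C`, which makes
  -- separate continuity joint.
  · refine continuous_prod_of_continuous_lipschitzWith _ (1 + C) (fun f => ?_) fun t => ?_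
    · exact (hX.lipschitz_time f).continuous.comp unitInterval.toNNReal_continuous
    · refine (hX.lipschitz (unitInterval.toNNReal t)).weaken ?_
      gcongr
      exact mul_le_of_le_one_left' t.2.2
  · simpa using hX.zero f
  · exact fun f _ g _ t _ => hlip t f g
  · intro f _ s t u _ _ hu
    have h := hX.dist_comp_le (unitInterval.toNNReal s) (unitInterval.toNNReal t) f
    have e : unitInterval.toNNReal u = unitInterval.toNNReal s + unitInterval.toNNReal t :=
      NNReal.coe_injective (by simpa using hu)
    simpa [e] using h
  · exact (hF t f).congr' (eulerIterate_eventuallyEq X t f).symm
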